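/- Let $R$ be an associative (not necessarily commutative) ring with identity, with Jacobson radical $J(R)$, and suppose that $R$ is semi-local, i.e. $R/J(R)$ is a semisimple ring. Call $R$ GNC (generalized nil-clean) if every non-unit of $R$ is the sum of an idempotent and a nilpotent element of $R$, and nil-clean if every element of $R$ is such a sum. Then the following conditions are equivalent: (1) $R$ is a GNC ring. (2) Either $R$ is a local ring and $J(R)$ is nil (each of its elements is nilpotent), or $R/J(R) \cong M_n(\mathbb{Z}_2)$ as rings for some integer $n \ge 1$ and $J(R)$ is nil, or $R$ is a nil-clean ring. Here $\mathbb{Z}_2$ denotes the ring $\mathbb{Z}/2\mathbb{Z}$. -/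

import Mathlib

/-- An element of a ring is nil-clean if it differs from some idempotent by a nilpotent. -/
def IsNilCleanElem {R : Type*} [Ring R] (a : R) : Prop :=
  ∃ e : R, IsIdempotentElem e ∧ IsNilpotent (a - e)

/-- A ring is nil-clean if each of its elements is nil-clean. -/
def IsNilCleanRing (R : Type*) [Ring R] : Prop :=
  ∀ a : R, IsNilCleanElem a

/-- A ring is generalized nil-clean (GNC) if every non-unit is the sum of an idempotent
and a nilpotent. -/
def IsGNCRing (R : Type*) [Ring R] : Prop :=
  ∀ a : R, ¬ IsUnit a → ∃ e q : R, IsIdempotentElem e ∧ IsNilpotent q ∧ a = e + q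

/-- A (not necessarily commutative) ring is semi-local if its quotient by the Jacobson radical
is a semisimple ring. -/
def IsSemilocalRing (R : Type*) [Ring R] : Prop :=
  IsSemisimpleRing (R ⧸ Ring.jacobson R)

/-- The Jacobson radical of the ring is nil: each of its elements is nilpotent. -/
def HasNilJacobson (R : Type*) [Ring R] : Prop :=
  ∀ x ∈ Ring.jacobson R, IsNilpotent x

/-! ### Nil-clean elements under ring homomorphisms. -/

section NilClean

variable {A B : Type*} [Ring A] [Ring B]

/-! Everything is decided in `R/J`. If `R` is GNC, then `J` is nil: a non-unit `x = e + q` in `J`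
has `e` nilpotent modulo `J`, so `e ∈ J` and `e = 0`. Conversely, if `J` is nil, idempotents lift
and nil-cleanness ascends from `R/J`.

By Wedderburn–Artin, `R/J` is a finite product of matrix rings over division rings. One factor of
size 1 makes `R` local. In one factor of size at least 2 every `d e_ii` is a non-unit, hence
nil-clean, and `eq_zero_or_eq_one_of_isNilCleanElem_single` forces the division ring to be `ZMod 2`.
With several factors, padding by zero makes each factor nil-clean, with the same conclusion.

What remains is that matrices over `ZMod 2` are nil-clean. A matrix makes the space a finite-length
`(ZMod 2)[X]`-module; block-triangular gluing reduces to simple modules, where `X` is multiplication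
by a field generator and an explicit idempotent of rank one or two is subtracted. -/

theorem IsNilCleanElem.map (f : A →+* B) {a : A} (h : IsNilCleanElem a) :
    IsNilCleanElem (f a) := by
  obtain ⟨e, he, hn⟩ := h
  exact ⟨f e, he.map f, by simpa using hn.map f⟩

theorem isGNCRing_iff : IsGNCRing A ↔ ∀ a : A, ¬ IsUnit a → IsNilCleanElem a := by
  refine forall₂_congr fun a _ => ⟨?_, ?_⟩
  · rintro ⟨e, q, he, hq, rfl⟩
    exact ⟨e, he, by simpa using hq⟩
  · rintro ⟨e, he, hq⟩
    exact ⟨e, a - e, he, hq, by abel⟩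

theorem IsNilCleanRing.isGNCRing (h : IsNilCleanRing A) : IsGNCRing A :=
  isGNCRing_iff.mpr fun a _ => h a

theorem IsNilCleanRing.of_surjective (f : A →+* B) (hf : Function.Surjective f)
    (h : IsNilCleanRing A) : IsNilCleanRing B := by
  intro b
  obtain ⟨a, rfl⟩ := hf b
  exact (h a).map f

theorem IsGNCRing.of_surjective (f : A →+* B) (hf : Function.Surjective f)
    (h : IsGNCRing A) : IsGNCRing B := by
  rw [isGNCRing_iff] at h ⊢
  intro b hb
  obtain ⟨a, rfl⟩ := hf b
  exact (h a fun ha => hb (ha.map f)).map f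

end NilClean

/-! ### Units, idempotents and nilpotents modulo the Jacobson radical. -/

section Jacobson

variable {R : Type*} [Ring R]

theorem isUnit_one_add_of_mem_jacobson {x : R} (hx : x ∈ Ring.jacobson R) : IsUnit (1 + x) := by
  have left_inv : ∀ y ∈ Ring.jacobson R, ∃ s, s * (1 + y) = 1 := fun y hy => by
    obtain ⟨s, hs⟩ := Ideal.exists_mul_sub_mem_of_sub_one_mem_jacobson (I := (⊥ : Ideal R))
      (1 + y) (by simpa [Ideal.jacobson_bot] using hy)
    exact ⟨s, sub_eq_zero.mp (by simpa using hs)⟩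
  obtain ⟨s, hs⟩ := left_inv x hx
  have hs' : s = 1 + -(s * x) := by
    rw [mul_add, mul_one] at hs
    rw [← hs]; abel
  obtain ⟨t, ht⟩ := left_inv (-(s * x)) (neg_mem (Ideal.mul_mem_left _ s hx))
  rw [← hs'] at ht
  have hts : t = 1 + x := by
    calc t = t * (s * (1 + x)) := by rw [hs, mul_one]
      _ = 1 + x := by rw [← mul_assoc, ht, one_mul]
  exact isUnit_iff_exists.mpr ⟨s, hts ▸ ht, hs⟩

theorem isUnit_of_isUnit_mk_jacobson {a : R}
    (h : IsUnit (Ideal.Quotient.mk (Ring.jacobson R) a)) : IsUnit a := by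
  obtain ⟨b', hab, hba⟩ := isUnit_iff_exists.mp h
  obtain ⟨b, rfl⟩ := Ideal.Quotient.mk_surjective b'
  rw [← map_mul, ← map_one (Ideal.Quotient.mk (Ring.jacobson R)), Ideal.Quotient.mk_eq_mk_iff_sub_mem]
    at hab hba
  have h1 := isUnit_one_add_of_mem_jacobson hab
  have h2 := isUnit_one_add_of_mem_jacobson hba
  rw [add_sub_cancel] at h1 h2
  obtain ⟨c, hc, -⟩ := isUnit_iff_exists.mp h1
  obtain ⟨d, -, hd⟩ := isUnit_iff_exists.mp h2
  have hl : (d * b) * a = 1 := by rw [mul_assoc, hd]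
  have hr : a * (b * c) = 1 := by rw [← mul_assoc, hc]
  exact isUnit_iff_exists.mpr ⟨d * b, by rw [left_inv_eq_right_inv hl hr, hr], hl⟩

theorem eq_zero_of_mem_jacobson_of_isIdempotentElem {e : R} (he : IsIdempotentElem e)
    (h : e ∈ Ring.jacobson R) : e = 0 := by
  have hu := isUnit_one_add_of_mem_jacobson (neg_mem h)
  have : (1 + -e) * e = 0 := by rw [add_mul, one_mul, neg_mul, he.eq, add_neg_cancel]
  exact hu.mul_right_eq_zero.mp this

theorem IsGNCRing.hasNilJacobson (h : IsGNCRing R) : HasNilJacobson R := by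
  intro x hx
  by_cases hu : IsUnit x
  -- A unit in the radical puts the idempotent 1 there, so the ring is zero.
  · have h0 : IsIdempotentElem (1 : R) := .one
    have := eq_zero_of_mem_jacobson_of_isIdempotentElem h0
      ((Ideal.eq_top_of_isUnit_mem _ hx hu) ▸ trivial)
    exact ⟨1, by rw [← one_mul (x ^ 1), this, zero_mul]⟩
  obtain ⟨e, he, k, hk⟩ := isGNCRing_iff.mp h x hu
  have hmk : Ideal.Quotient.mk (Ring.jacobson R) e = 0 := by
    have h1 : Ideal.Quotient.mk (Ring.jacobson R) (x - e) =
        -Ideal.Quotient.mk (Ring.jacobson R) e := by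
      rw [map_sub, Ideal.Quotient.eq_zero_iff_mem.mpr hx, zero_sub]
    have h2 : IsNilpotent (Ideal.Quotient.mk (Ring.jacobson R) e) := by
      rw [← isNilpotent_neg_iff, ← h1]
      exact (show IsNilpotent (x - e) from ⟨k, hk⟩).map _
    obtain ⟨m, hm⟩ := h2
    have := (he.map (Ideal.Quotient.mk (Ring.jacobson R))).pow_succ_eq m
    rw [← this, pow_succ, hm, zero_mul]
  have := eq_zero_of_mem_jacobson_of_isIdempotentElem he (Ideal.Quotient.eq_zero_iff_mem.mp hmk)
  exact ⟨k, by simpa [this] using hk⟩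

theorem HasNilJacobson.isNilCleanRing (hJ : HasNilJacobson R)
    (h : IsNilCleanRing (R ⧸ Ring.jacobson R)) : IsNilCleanRing R := by
  intro a
  obtain ⟨e', he', k, hk⟩ := h (Ideal.Quotient.mk _ a)
  obtain ⟨e, he, rfl⟩ := exists_isIdempotentElem_eq_of_ker_isNilpotent
    (Ideal.Quotient.mk (Ring.jacobson R))
    (fun x hx => hJ x (Ideal.Quotient.eq_zero_iff_mem.mp hx)) e'
    (Ideal.Quotient.mk_surjective e') he'
  refine ⟨e, he, IsNilpotent.of_pow (m := k) (hJ _ ?_)⟩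
  rw [← Ideal.Quotient.eq_zero_iff_mem, map_pow, map_sub, hk]

/-- Over a not necessarily commutative local ring, non-units lie in the Jacobson radical. -/
theorem mem_jacobson_of_not_isUnit [IsLocalRing R] {a : R} (ha : ¬ IsUnit a) :
    a ∈ Ring.jacobson R := by
  have not_left : ∀ b, b * a ≠ 1 := by
    intro b hb
    -- A one-sided inverse makes `a * b` idempotent, and locality leaves only 0 and 1.
    have hf : IsIdempotentElem (a * b) := by
      rw [IsIdempotentElem, mul_assoc, ← mul_assoc b, hb, one_mul]
    rcases IsLocalRing.isUnit_or_isUnit_of_add_one (add_sub_cancel (a * b) 1) with h | h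
    · have : a * b = 1 := h.mul_left_cancel (by rw [hf.eq, mul_one])
      exact ha (isUnit_iff_exists.mpr ⟨b, this, hb⟩)
    · have h0 : a * b = 0 :=
        h.mul_right_eq_zero.mp (by rw [sub_mul, one_mul, hf.eq, sub_self])
      refine one_ne_zero (α := R) ?_
      calc (1 : R) = b * a * (b * a) := by rw [hb, one_mul]
        _ = b * (a * b) * a := by simp only [mul_assoc]
        _ = 0 := by rw [h0, mul_zero, zero_mul]
  rw [← Ideal.jacobson_bot, Ideal.mem_jacobson_iff]
  intro y
  have hu : IsUnit (1 + y * a) := by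
    rcases IsLocalRing.isUnit_or_isUnit_of_add_one
      (show (1 + y * a) + -(y * a) = 1 by abel) with h | h
    · exact h
    · obtain ⟨c, -, hc⟩ := isUnit_iff_exists.mp h
      exact absurd (by rw [← hc]; simp [mul_assoc]) (not_left (-(c * y)))
  obtain ⟨c, -, hc⟩ := isUnit_iff_exists.mp hu
  refine ⟨c, ?_⟩
  rw [Ideal.mem_bot, ← hc]
  noncomm_ring

theorem IsLocalRing.isGNCRing_of_hasNilJacobson [IsLocalRing R] (hJ : HasNilJacobson R) :
    IsGNCRing R :=
  isGNCRing_iff.mpr fun a ha =>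
    ⟨0, .zero, by simpa using hJ a (mem_jacobson_of_not_isUnit ha)⟩

theorem isLocalRing_of_quotient_jacobson [Nontrivial R]
    (h : ∀ x : R ⧸ Ring.jacobson R, x = 0 ∨ IsUnit x) : IsLocalRing R where
  isUnit_or_isUnit_of_add_one {a b} hab := by
    rcases h (Ideal.Quotient.mk _ a) with ha | ha
    · right
      have := isUnit_one_add_of_mem_jacobson (neg_mem (Ideal.Quotient.eq_zero_iff_mem.mp ha))
      rwa [← sub_eq_add_neg, ← hab, add_sub_cancel_left] at this
    · exact .inl (isUnit_of_isUnit_mk_jacobson ha)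

end Jacobson

/-! ### Nil-clean multiples of a diagonal matrix unit. -/

section MatrixUnits

open Matrix

variable {ι D : Type*} [Fintype ι] [DecidableEq ι] [DivisionRing D]

/-- An idempotent `E` of a matrix ring over a division ring with `d • e_{ii} - E` nilpotent and
`d ≠ 0` is of rank one, with a factorization normalized at the index `i`. -/
theorem exists_rank_one_of_isNilpotent_single_sub {i : ι} {d : D} (hd : d ≠ 0)
    {E : Matrix ι ι D} (hE : IsIdempotentElem E) (hN : IsNilpotent (single i i d - E)) :
    ∃ u f : ι → D, u i = 1 ∧ f ⬝ᵥ u = 1 ∧ E = vecMulVec u f := by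
  -- On such a `v` the nilpotent acts as -1. Hence the `i`-th coordinate is injective on the image
  -- of `E`, which bounds the rank by one.
  have fixed_eq_zero : ∀ v : ι → D, E *ᵥ v = v → v i = 0 → v = 0 := by
    intro v hv hi
    obtain ⟨k, hk⟩ := hN
    have hNv : (single i i d - E) *ᵥ v = (-1 : ℤ) • v := by
      rw [sub_mulVec, hv, single_mulVec, hi]
      simp
    have hpow : ∀ m : ℕ, (single i i d - E) ^ m *ᵥ v = (-1 : ℤ) ^ m • v := by
      intro m
      induction m with
      | zero => simp
      | succ m ih => rw [pow_succ, ← mulVec_mulVec, hNv, mulVec_smul, ih, smul_smul, pow_succ']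
    have := hpow k
    rw [hk, zero_mulVec] at this
    rcases neg_one_pow_eq_or ℤ k with h | h <;> rw [h] at this <;> simpa using this.symm
  have hcol : ∀ j, E *ᵥ E.col j = E.col j := by
    intro j
    ext r
    exact congrFun (congrFun hE r) j
  obtain ⟨j, hj⟩ : ∃ j, E i j ≠ 0 := by
    by_contra! hall
    have h0 : E = 0 := by
      ext r j
      exact congrFun (fixed_eq_zero (E.col j) (hcol j) (hall j)) r
    obtain ⟨k, hk⟩ := hN
    rw [h0, sub_zero] at hk
    have hpow : ∀ m : ℕ, single i i d ^ (m + 1) = single i i (d ^ (m + 1)) := by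
      intro m
      induction m with
      | zero => simp
      | succ m ih => rw [pow_succ, ih, single_mul_single_same, pow_succ d (m + 1)]
    have := congrFun (congrFun (hpow k) i) i
    rw [pow_succ, hk, zero_mul] at this
    simp only [Matrix.zero_apply, single_apply_same] at this
    exact pow_ne_zero _ hd this.symm
  let u : ι → D := fun r => E r j * (E i j)⁻¹
  have hu : E *ᵥ u = u := by
    ext r
    simp only [u, mulVec, dotProduct, ← mul_assoc, ← Finset.sum_mul]
    congr 1
    exact congrFun (hcol j) r
  have hui : u i = 1 := mul_inv_cancel₀ hj
  have hfac : E = vecMulVec u (E.row i) := by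
    ext r s
    have := fixed_eq_zero (fun r => E r s - u r * E i s) (by
      ext r
      have h1 := congrFun (hcol s) r
      have h2 := congrFun hu r
      simp only [mulVec, dotProduct, mul_sub, Finset.sum_sub_distrib, ← mul_assoc,
        ← Finset.sum_mul, col_apply] at h1 h2 ⊢
      rw [h1, h2]) (by simp [hui])
    exact sub_eq_zero.mp (congrFun this r)
  refine ⟨u, E.row i, hui, ?_, hfac⟩
  rw [← hui]
  exact congrFun hu i

theorem eq_zero_or_eq_one_of_isNilCleanElem_single {i : ι} {d : D}
    (h : IsNilCleanElem (single i i d : Matrix ι ι D)) : d = 0 ∨ d = 1 := by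
  by_contra! hd
  obtain ⟨hd0, hd1⟩ := hd
  obtain ⟨E, hE, hN⟩ := h
  obtain ⟨u, f, hui, hfu, rfl⟩ := exists_rank_one_of_isNilpotent_single_sub hd0 hE hN
  set N := single i i d - vecMulVec u f with hNdef
  have hNv : ∀ (v : ι → D) (r : ι), (N *ᵥ v) r = (Pi.single i (d * v i) : ι → D) r - u r * (f ⬝ᵥ v) := by
    intro v r
    rw [hNdef, sub_mulVec, Pi.sub_apply]
    congr 1
    · rw [single_mulVec]
      rfl
    · simp only [mulVec, dotProduct, vecMulVec_apply, Finset.mul_sum, mul_assoc]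
  -- a nonzero right eigenvector with invertible eigenvalue is impossible
  have no_eigen : ∀ (v : ι → D) (c : D), (∀ r, (N *ᵥ v) r = v r * c) → c ≠ 0 → v = 0 := by
    intro v c hv hc
    obtain ⟨k, hk⟩ := hN
    have hpow : ∀ m : ℕ, ∀ r, (N ^ m *ᵥ v) r = v r * c ^ m := by
      intro m
      induction m with
      | zero => simp
      | succ m ih =>
        intro r
        have : N *ᵥ v = fun r => v r * c := funext hv
        rw [pow_succ, ← mulVec_mulVec, this, pow_succ, ← mul_assoc, ← ih r]
        simp only [mulVec, dotProduct, Finset.sum_mul, mul_assoc]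
    ext r
    have := hpow k r
    rw [hk, zero_mulVec, Pi.zero_apply] at this
    simpa [hc] using this.symm
  by_cases hfi : f i = 1
  -- `d e_i - u` is an eigenvector for `d - 1`, and its `i`-th coordinate is `d - 1`.
  · have := no_eigen (fun r => (Pi.single i d : ι → D) r - u r) (d - 1) (fun r => by
      rw [hNv]
      have : (f ⬝ᵥ fun r => (Pi.single i d : ι → D) r - u r) = d - 1 := by
        have : (fun r => (Pi.single i d : ι → D) r - u r) = Pi.single i d - u := rfl
        rw [this, dotProduct_sub, dotProduct_single, hfi, hfu, one_mul]
      rw [this, hui, Pi.single_eq_same]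
      by_cases hr : r = i
      · subst hr; simp [hui, sub_mul]
      · simp [hr]) (sub_ne_zero.mpr hd1)
    have := congrFun this i
    simp [hui, sub_eq_zero, hd1] at this
  · obtain ⟨j, hji, huj⟩ : ∃ j, j ≠ i ∧ u j ≠ 0 := by
      by_contra! hall
      apply hfi
      rw [← hfu, dotProduct, Finset.sum_eq_single i (fun r _ hr => by rw [hall r hr, mul_zero])
        (by simp), hui, mul_one]
    -- Kernel and image of `N` meet trivially, so nilpotency forces `N = 0`; but `(N u)_j = -u_j` is
    -- nonzero.
    have ker_eq_zero : ∀ v : ι → D, N *ᵥ (N *ᵥ v) = 0 → N *ᵥ v = 0 := by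
      intro v hv
      have h1 := congrFun hv j
      rw [hNv (N *ᵥ v)] at h1
      have hfw : f ⬝ᵥ (N *ᵥ v) = 0 := by simpa [hji, huj] using h1
      have h2 := congrFun hv i
      rw [hNv (N *ᵥ v), hfw] at h2
      have hwi : (N *ᵥ v) i = 0 := by simpa [hd0] using h2
      have hNv' : N *ᵥ v = (Pi.single i (d * v i) : ι → D) - fun r => u r * (f ⬝ᵥ v) := funext (hNv v)
      have h3 : d * v i = f ⬝ᵥ v := by
        rw [hNv v, Pi.single_eq_same, hui, one_mul] at hwi
        exact sub_eq_zero.mp hwi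
      have h4 : (f ⬝ᵥ fun r => u r * (f ⬝ᵥ v)) = f ⬝ᵥ v := by
        simp only [dotProduct, ← mul_assoc, ← Finset.sum_mul]
        rw [show ∑ r, f r * u r = 1 from hfu, one_mul]
      rw [hNv', dotProduct_sub, dotProduct_single, h4, h3, ← sub_one_mul] at hfw
      have h5 : f ⬝ᵥ v = 0 := (mul_eq_zero.mp hfw).resolve_left (sub_ne_zero.mpr hfi)
      rw [hNv', h3, h5]
      ext r; simp
    have hpow : ∀ m : ℕ, ∀ v, N ^ m *ᵥ (N *ᵥ v) = 0 → N *ᵥ v = 0 := by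
      intro m
      induction m with
      | zero => simp
      | succ m ih =>
        intro v hv
        rw [pow_succ, ← mulVec_mulVec] at hv
        exact ker_eq_zero v (ih _ hv)
    obtain ⟨k, hk⟩ := hN
    have h1 := congrFun (hpow k (Pi.single i 1) (by rw [hk, zero_mulVec])) j
    have h2 := congrFun (hpow k u (by rw [hk, zero_mulVec])) j
    rw [hNv, hfu] at h2
    simp [hji, huj] at h2

end MatrixUnits

/-! ### Explicit idempotents for multiplication by a power-basis generator. -/

section Cyclic

open Polynomial

theorem pow_eq_zero_of_span_iterates_eq_top {F V : Type*} [CommRing F] [AddCommGroup V]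
    [Module F V] {N : Module.End F V} {v : V} {n : ℕ} (hv : (N ^ n) v = 0)
    (hspan : ⊤ ≤ Submodule.span F (Set.range fun k : ℕ => (N ^ k) v)) : N ^ n = 0 := by
  refine LinearMap.ext_on (top_le_iff.mp hspan) ?_
  rintro _ ⟨k, rfl⟩
  rw [← Module.End.mul_apply, ← pow_add, add_comm, pow_add, Module.End.mul_apply, hv, map_zero,
    LinearMap.zero_apply]

/-- The value at `gen ^ dim` is a combination of coefficients of the minimal polynomial, which the
two cases below test. -/
theorem PowerBasis.exists_linearMap {F K : Type*} [CommRing F] [CommRing K] [Algebra F K]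
    (pb : PowerBasis F K) (g : ℕ → F) : ∃ φ : K →ₗ[F] F, (∀ i < pb.dim, φ (pb.gen ^ i) = g i) ∧
      φ (pb.gen ^ pb.dim) = ∑ i : Fin pb.dim, pb.basis.repr (pb.gen ^ pb.dim) i * g i := by
  refine ⟨pb.basis.constr F fun i => g i, fun i hi => ?_, ?_⟩
  · have := pb.basis.constr_basis F (fun i => g i) ⟨i, hi⟩
    rwa [pb.basis_eq_pow] at this
  · simp [Module.Basis.constr_apply_fintype]

theorem PowerBasis.top_le_span_of_pow_mem {F K : Type*} [CommRing F] [CommRing K] [Algebra F K]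
    (pb : PowerBasis F K) {S : Submodule F K} (h : ∀ i < pb.dim, pb.gen ^ i ∈ S) : ⊤ ≤ S := by
  rw [← pb.basis.span_eq, Submodule.span_le]
  rintro _ ⟨i, rfl⟩
  rw [pb.basis_eq_pow]
  exact h i i.2

variable {K : Type*} [CommRing K] [Algebra (ZMod 2) K] (pb : PowerBasis (ZMod 2) K)

/-- Here the companion matrix has trace 1. Subtracting its last column leaves the nilpotent shift of
the power basis. -/
theorem isNilCleanElem_mulLeft_gen_of_last_eq_one {φ : K →ₗ[ZMod 2] ZMod 2}
    (hφ : ∀ i < pb.dim, φ (pb.gen ^ i) = if i + 1 = pb.dim then 1 else 0)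
    (hφn : φ (pb.gen ^ pb.dim) = 1) :
    IsNilCleanElem (LinearMap.mulLeft (ZMod 2) pb.gen) := by
  set E : Module.End (ZMod 2) K := φ.smulRight (pb.gen ^ pb.dim) with hEdef
  set N := LinearMap.mulLeft (ZMod 2) pb.gen - E with hN
  have hNv : ∀ y, N y = pb.gen * y - φ y • pb.gen ^ pb.dim := fun y => by
    simp [hN, hEdef]
  refine ⟨E, ?_, pb.dim, ?_⟩
  · ext y
    simp [hEdef, hφn]
  have hiter : ∀ i < pb.dim, (N ^ i) 1 = pb.gen ^ i := by
    intro i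
    induction i with
    | zero => simp
    | succ i ih =>
      intro hi
      rw [pow_succ', Module.End.mul_apply, ih (by omega), hNv, hφ i (by omega), if_neg (by omega),
        zero_smul, sub_zero, pow_succ']
  apply pow_eq_zero_of_span_iterates_eq_top (v := 1)
  · rcases Nat.eq_zero_or_pos pb.dim with h0 | h0
    · rw [h0] at hφn ⊢
      have : (1 : K) = 0 := by
        rw [← pb.basis.sum_repr 1]
        have : IsEmpty (Fin pb.dim) := by rw [h0]; infer_instance
        simp
      simpa using this
    · obtain ⟨m, hm⟩ := Nat.exists_eq_succ_of_ne_zero h0.ne'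
      rw [hm, pow_succ', Module.End.mul_apply, hiter m (by omega), hNv, hφ m (by omega),
        if_pos (by omega), one_smul, hm, pow_succ', sub_self]
  · exact pb.top_le_span_of_pow_mem fun i hi => Submodule.subset_span ⟨i, hiter i hi⟩

/-- With trace 0 a rank-two idempotent is used: `ψ, φ` are dual to `a, u`. The nilpotent runs along
the chain `1, a, a² - a, a³ - a², …`, ending with `u - u = 0`. -/
theorem isNilCleanElem_mulLeft_gen_of_last_eq_zero {φ ψ : K →ₗ[ZMod 2] ZMod 2}
    (hφ : ∀ i < pb.dim, φ (pb.gen ^ i) = if i + 1 = pb.dim then 1 else 0)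
    (hψ : ∀ i < pb.dim, ψ (pb.gen ^ i) = if i = 0 then 0 else 1)
    (hφn : φ (pb.gen ^ pb.dim) = 0) (hψn : ψ (pb.gen ^ pb.dim) = 1) (hdim : 3 ≤ pb.dim) :
    IsNilCleanElem (LinearMap.mulLeft (ZMod 2) pb.gen) := by
  obtain ⟨m, hm⟩ : ∃ m, pb.dim = m + 3 := ⟨pb.dim - 3, by omega⟩
  set a := pb.gen with ha
  rw [hm] at hφ hψ hφn hψn
  have hφ' : ∀ i < m + 2, φ (a ^ i) = 0 := fun i hi => by
    rw [hφ i (by omega), if_neg (by omega)]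
  have hψ' : ∀ i < m + 2, ψ (a ^ (i + 1)) = 1 := fun i hi => by
    rw [hψ (i + 1) (by omega), if_neg (by omega)]
  have hφl : φ (a ^ (m + 2)) = 1 := by rw [hφ _ (by omega), if_pos rfl]
  have hψ0 : ψ 1 = 0 := by simpa using hψ 0 (by omega)
  have hφ0 : φ 1 = 0 := by simpa using hφ' 0 (by omega)
  have hφ1 : φ a = 0 := by simpa using hφ' 1 (by omega)
  have hψ1 : ψ a = 1 := by simpa using hψ' 0 (by omega)
  set u := a ^ (m + 3) - a ^ (m + 2) with hu
  have hφu : φ u = 1 := by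
    rw [hu, map_sub, hφn, hφl]; decide
  have hψu : ψ u = 0 := by rw [hu, map_sub, hψn, hψ' (m + 1) (by omega), sub_self]
  set E : Module.End (ZMod 2) K := ψ.smulRight a + φ.smulRight u with hEdef
  set N := LinearMap.mulLeft (ZMod 2) a - E with hN
  have hNv : ∀ y, N y = a * y - (ψ y • a + φ y • u) := fun y => by
    simp [hN, hEdef]
  have hN1 : N 1 = a := by rw [hNv, hψ0, hφ0]; simp
  have hiter : ∀ i < m + 1, (N ^ (i + 2)) 1 = a ^ (i + 2) - a ^ (i + 1) := by
    intro i
    induction i with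
    | zero =>
      intro _
      rw [zero_add, zero_add, pow_two, Module.End.mul_apply, hN1, hNv, hψ1, hφ1]
      simp [pow_two]
    | succ i ih =>
      intro hi
      rw [pow_succ', Module.End.mul_apply, ih (by omega), hNv, map_sub, map_sub,
        hψ' (i + 1) (by omega), hψ' i (by omega), hφ' (i + 2) (by omega), hφ' (i + 1) (by omega)]
      simp only [sub_self, zero_smul, add_zero, sub_zero]
      ring
  refine ⟨E, ?_, m + 3, ?_⟩
  · ext y
    simp [hEdef, hψ1, hφ1, hψu, hφu]
  apply pow_eq_zero_of_span_iterates_eq_top (v := 1)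
  · rw [pow_succ', Module.End.mul_apply, hiter m (by omega), hNv, map_sub, map_sub,
      hψ' (m + 1) (by omega), hψ' m (by omega), hφl, hφ' (m + 1) (by omega), hu]
    simp only [sub_self, zero_smul, zero_add, sub_zero, one_smul]
    ring
  · apply pb.top_le_span_of_pow_mem
    rw [hm]
    intro i
    induction i with
    | zero => exact fun _ => Submodule.subset_span ⟨0, by simp⟩
    | succ i ih =>
      intro hi
      rcases i with _ | i
      · exact Submodule.subset_span ⟨1, show (N ^ 1) 1 = _ by rw [pow_one, hN1, zero_add, pow_one]⟩
      · have h1 := Submodule.subset_span (R := ZMod 2) (s := Set.range fun k : ℕ => (N ^ k) 1)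
          ⟨i + 2, hiter i (by omega)⟩
        have := add_mem h1 (ih (by omega))
        rwa [sub_add_cancel] at this

end Cyclic

/-! ### Finite extensions of `ZMod 2`. -/

section Field

open Polynomial

/-- Multiplication by the generator of a finite extension of `ZMod 2` is nil-clean. -/
theorem isNilCleanElem_mulLeft_gen {K : Type*} [Field K] [Algebra (ZMod 2) K]
    (pb : PowerBasis (ZMod 2) K) : IsNilCleanElem (LinearMap.mulLeft (ZMod 2) pb.gen) := by
  by_cases halg : ∃ x, algebraMap (ZMod 2) K x = pb.gen
  · obtain ⟨x, hx⟩ := halg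
    refine ⟨LinearMap.mulLeft (ZMod 2) pb.gen, ?_, by simp⟩
    have hxx : ∀ x : ZMod 2, x * x = x := by decide
    ext y
    rw [Module.End.mul_apply, LinearMap.mulLeft_apply, LinearMap.mulLeft_apply, ← mul_assoc, ← hx,
      ← map_mul, hxx x]
  have hroot : ∀ x, (minpoly (ZMod 2) pb.gen).eval x ≠ 0 := fun x hx =>
    halg ⟨x, minpoly.root pb.isIntegral_gen hx⟩
  obtain ⟨φ, hφ, hφn⟩ := pb.exists_linearMap fun i => if i + 1 = pb.dim then 1 else 0
  obtain ⟨ψ, hψ, hψn⟩ := pb.exists_linearMap fun i => if i = 0 then 0 else 1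
  obtain ⟨χ, -, hχn⟩ := pb.exists_linearMap fun i => if i = 0 then 1 else 0
  have two : ∀ x : ZMod 2, x ≠ 0 → x = 1 := by decide
  rcases eq_or_ne (φ (pb.gen ^ pb.dim)) 0 with h0 | h0
  · have hdim0 : pb.dim ≠ 0 := pb.dim_ne_zero
    -- The minimal polynomial takes the value 1 at both 0 and 1: its constant coefficient is 1, and
    -- the coefficients in degrees 1 to `dim - 1` sum to 1. This gives `ψ (gen ^ dim) = 1`.
    have e0 := two _ (hroot 0)
    have e1 := two _ (hroot 1)
    rw [← pb.minpolyGen_eq, PowerBasis.minpolyGen] at e0 e1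
    simp only [eval_sub, eval_pow, eval_X, eval_finsetSum, eval_mul, eval_C, one_pow, mul_one,
      zero_pow hdim0, zero_pow_eq] at e0 e1
    have hχ1 : χ (pb.gen ^ pb.dim) = 1 := by
      rw [hχn]
      rw [zero_sub] at e0
      rw [← neg_eq_iff_eq_neg.mpr e0.symm]
      decide
    have hψ1 : ψ (pb.gen ^ pb.dim) = 1 := by
      have : ψ (pb.gen ^ pb.dim) + χ (pb.gen ^ pb.dim) = 0 := by
        rw [hχn, hψn, ← Finset.sum_add_distrib]
        refine Eq.trans (Finset.sum_congr rfl fun i _ => ?_) (sub_eq_self.mp e1)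
        split_ifs <;> simp
      rw [hχ1] at this
      rw [eq_neg_of_add_eq_zero_left this]
      decide
    refine isNilCleanElem_mulLeft_gen_of_last_eq_zero pb hφ hψ h0 hψ1 ?_
    by_contra! hlt
    refine absurd (hψ1.symm.trans (hψn.trans ?_)) one_ne_zero
    -- In dimension 1 the sum for `ψ` vanishes termwise; in dimension 2 it equals the one for `φ`,
    -- which is 0.
    rcases show pb.dim = 1 ∨ pb.dim = 2 by omega with h | h
    · refine Finset.sum_eq_zero fun i _ => ?_
      have := i.2
      rw [if_pos (by omega), mul_zero]
    · refine (Finset.sum_congr rfl fun i _ => ?_).trans (hφn.symm.trans h0)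
      have := i.2
      rcases Nat.eq_zero_or_pos i with h' | h'
      · rw [if_pos h', if_neg (by omega)]
      · rw [if_neg (by omega), if_pos (by omega)]
  · exact isNilCleanElem_mulLeft_gen_of_last_eq_one pb hφ (two _ h0)

end Field

/-! ### From simple modules to arbitrary matrices over `ZMod 2`. -/

section FiniteLength

open Polynomial

/-- The inclusion of `Module.End R M` in the ring of additive endomorphisms. -/
def endToAddMonoidEnd (R M : Type*) [CommRing R] [AddCommGroup M] [Module R M] :
    Module.End R M →+* AddMonoid.End M where
  toFun f := f.toAddMonoidHom
  map_one' := rfl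
  map_mul' _ _ := rfl
  map_zero' := rfl
  map_add' _ _ := rfl

/-- An additive equivalence intertwining endomorphisms transports nil-cleanness. -/
theorem IsNilCleanElem.of_addEquiv {M M' : Type*} [AddCommGroup M] [AddCommGroup M']
    (g : M ≃+ M') {f : AddMonoid.End M} {f' : AddMonoid.End M'} (h : IsNilCleanElem f)
    (hg : ∀ x, g (f x) = f' (g x)) : IsNilCleanElem f' := by
  let c : AddMonoid.End M →+* AddMonoid.End M' :=
    { toFun := fun k => (g.toAddMonoidHom.comp k).comp g.symm.toAddMonoidHom
      map_one' := by ext x; exact g.apply_symm_apply x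
      map_mul' := fun a b => by
        ext x
        change g (a (b (g.symm x))) = g (a (g.symm (g (b (g.symm x)))))
        rw [g.symm_apply_apply]
      map_zero' := by ext x; exact map_zero g
      map_add' := fun a b => by ext x; exact map_add g _ _ }
  have := h.map c
  convert this
  ext x
  change f' x = g (f (g.symm x))
  rw [hg, g.apply_symm_apply]

theorem isNilCleanElem_toAddMonoidEnd_of_isSimpleModule {M : Type*} [AddCommGroup M]
    [Module (ZMod 2)[X] M] [IsSimpleModule (ZMod 2)[X] M] :
    IsNilCleanElem (Module.toAddMonoidEnd (ZMod 2)[X] M X) := by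
  obtain ⟨I, hI, ⟨e⟩⟩ := isSimpleModule_iff_quot_maximal.mp ‹IsSimpleModule (ZMod 2)[X] M›
  obtain ⟨p, rfl⟩ := IsPrincipalIdealRing.principal I
  have hp0 : p ≠ 0 := by
    rintro rfl
    refine Ring.ne_bot_of_isMaximal_of_not_isField hI (Polynomial.not_isField _) ?_
    simp
  have hp : Irreducible p := ((Ideal.span_singleton_prime hp0).mp hI.isPrime).irreducible
  have : Fact (Irreducible p) := ⟨hp⟩
  have h := (isNilCleanElem_mulLeft_gen (AdjoinRoot.powerBasis hp0)).map
    (endToAddMonoidEnd (ZMod 2) (AdjoinRoot p))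
  refine h.of_addEquiv (M := AdjoinRoot p) e.symm.toAddEquiv fun x => ?_
  refine Eq.trans ?_ (e.symm.map_smul X x)
  obtain ⟨q, rfl⟩ := AdjoinRoot.mk_surjective x
  rfl

/-- Along the additive splitting `a` is block triangular. The block-diagonal idempotent built from
`E₁` and `E₂` leaves nilpotent diagonal blocks. The section `s` need not be `R`-linear, hence
additive endomorphisms. -/
theorem isNilCleanElem_toAddMonoidEnd_of_quotient {R M : Type*} [CommRing R] [AddCommGroup M]
    [Module R M] (N : Submodule R M) (a : R) (s : M ⧸ N →+ M)
    (hs : ∀ x, N.mkQ (s x) = x) (hN : IsNilCleanElem (Module.toAddMonoidEnd R N a))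
    (hQ : IsNilCleanElem (Module.toAddMonoidEnd R (M ⧸ N) a)) :
    IsNilCleanElem (Module.toAddMonoidEnd R M a) := by
  obtain ⟨E₁, hE₁, k₁, hk₁⟩ := hN
  obtain ⟨E₂, hE₂, k₂, hk₂⟩ := hQ
  have hE₁' : ∀ x, E₁ (E₁ x) = E₁ x := fun x => DFunLike.congr_fun hE₁ x
  have hE₂' : ∀ x, E₂ (E₂ x) = E₂ x := fun x => DFunLike.congr_fun hE₂ x
  let π : M →+ M ⧸ N := N.mkQ.toAddMonoidHom
  have hπs : ∀ x, π (s x) = x := hs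
  have hπN : ∀ x : N, π x = 0 := fun x => (Submodule.Quotient.mk_eq_zero N).mpr x.2
  let r : M →+ N := AddMonoidHom.codRestrict (AddMonoidHom.id M - s.comp π) N fun m => by
    rw [← Submodule.Quotient.mk_eq_zero N]
    change π (m - s (π m)) = 0
    rw [map_sub, hπs, sub_self]
  have hr : ∀ m, (r m : M) = m - s (π m) := fun m => rfl
  have hrN : ∀ x : N, r x = x := fun x => Subtype.ext (by rw [hr, hπN, map_zero, sub_zero])
  have hrs : ∀ x, r (s x) = 0 := fun x => Subtype.ext (by rw [hr, hπs, sub_self]; rfl)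
  let E : AddMonoid.End M :=
    (N.subtype.toAddMonoidHom.comp (AddMonoidHom.comp E₁ r)) + s.comp (AddMonoidHom.comp E₂ π)
  have hE : ∀ m, E m = E₁ (r m) + s (E₂ (π m)) := fun m => rfl
  have hπE : ∀ m, π (E m) = E₂ (π m) := fun m => by rw [hE, map_add, hπN, hπs, zero_add]
  have hrE : ∀ m, r (E m) = E₁ (r m) := fun m => by rw [hE, map_add, hrN, hrs, add_zero]
  have hEN : ∀ x : N, E x = E₁ x := fun x => by rw [hE, hrN, hπN, map_zero, map_zero, add_zero]
  set L := Module.toAddMonoidEnd R M a - E with hL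
  have hπL : ∀ (k : ℕ) m, π ((L ^ k) m) = ((Module.toAddMonoidEnd R (M ⧸ N) a - E₂) ^ k) (π m) := by
    intro k
    induction k with
    | zero => exact fun m => rfl
    | succ k ih =>
      intro m
      rw [pow_succ, pow_succ]
      change π ((L ^ k) (L m)) = ((_ - E₂) ^ k) ((Module.toAddMonoidEnd R (M ⧸ N) a - E₂) (π m))
      rw [ih]
      congr 1
      change π (a • m - E m) = a • π m - E₂ (π m)
      rw [map_sub, hπE]
      rfl
  have hLN : ∀ (k : ℕ) (x : N), (L ^ k) x = (((Module.toAddMonoidEnd R N a - E₁) ^ k) x : N) := by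
    intro k
    induction k with
    | zero => exact fun m => rfl
    | succ k ih =>
      intro x
      rw [pow_succ, pow_succ]
      change (L ^ k) (L x) = (((_ - E₁) ^ k) ((Module.toAddMonoidEnd R N a - E₁) x) : N)
      rw [← ih]
      congr 1
      change a • (x : M) - E x = ((a • x - E₁ x : N) : M)
      rw [hEN]
      rfl
  refine ⟨E, ?_, k₁ + k₂, ?_⟩
  · ext m
    change E (E m) = E m
    rw [hE (E m), hπE, hrE, hE₁', hE₂', ← hE]
  · ext m
    have hmem : (L ^ k₂) m ∈ N := by
      rw [← Submodule.Quotient.mk_eq_zero N]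
      change π ((L ^ k₂) m) = 0
      rw [hπL, hk₂]
      rfl
    rw [pow_add]
    change (L ^ k₁) ((⟨(L ^ k₂) m, hmem⟩ : N) : M) = 0
    rw [hLN, hk₁]
    rfl

theorem isNilCleanElem_toAddMonoidEnd_of_isFiniteLength {M : Type*} [AddCommGroup M]
    [Module (ZMod 2)[X] M] (h : IsFiniteLength (ZMod 2)[X] M) :
    IsNilCleanElem (Module.toAddMonoidEnd (ZMod 2)[X] M X) := by
  induction h with
  | of_subsingleton => exact ⟨0, .zero, 1, by ext x; exact Subsingleton.elim _ _⟩
  | @of_simple_quotient M _ _ N _ _ ih =>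
    let : Module (ZMod 2) M := Module.compHom M (C : ZMod 2 →+* (ZMod 2)[X])
    let : Module (ZMod 2) (M ⧸ N) := Module.compHom (M ⧸ N) (C : ZMod 2 →+* (ZMod 2)[X])
    let π : M →ₗ[ZMod 2] M ⧸ N := AddMonoidHom.toZModLinearMap 2 N.mkQ.toAddMonoidHom
    obtain ⟨s, hs⟩ := π.exists_rightInverse_of_surjective
      (LinearMap.range_eq_top.mpr N.mkQ_surjective)
    exact isNilCleanElem_toAddMonoidEnd_of_quotient N X s.toAddMonoidHom
      (fun x => LinearMap.congr_fun hs x) ih isNilCleanElem_toAddMonoidEnd_of_isSimpleModule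

/-- Matrix rings over `ZMod 2` are nil-clean. -/
theorem isNilCleanRing_matrix_zmod_two (ι : Type*) [Fintype ι] [DecidableEq ι] :
    IsNilCleanRing (Matrix ι ι (ZMod 2)) := by
  suffices h : IsNilCleanRing (Module.End (ZMod 2) (ι → ZMod 2)) from
    h.of_surjective (Matrix.toLinAlgEquiv' (R := ZMod 2) (n := ι)).symm.toRingEquiv.toRingHom
      (Matrix.toLinAlgEquiv' (R := ZMod 2) (n := ι)).symm.surjective
  intro T
  let V := ι → ZMod 2
  let : Module (ZMod 2)[X] V := Module.compHom V
    ((endToAddMonoidEnd (ZMod 2) V).comp (aeval T : (ZMod 2)[X] →ₐ[ZMod 2] _).toRingHom)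
  have hX : ∀ v : V, (X : (ZMod 2)[X]) • v = T v := fun v =>
    LinearMap.congr_fun (aeval_X T) v
  have hfin : IsFiniteLength (ZMod 2)[X] V :=
    isFiniteLength_iff_isNoetherian_isArtinian.mpr ⟨inferInstance, inferInstance⟩
  let g : AddMonoid.End V →+* Module.End (ZMod 2) V :=
    { toFun := fun f => AddMonoidHom.toZModLinearMap 2 f
      map_one' := rfl
      map_mul' := fun _ _ => rfl
      map_zero' := rfl
      map_add' := fun _ _ => rfl }
  have := (isNilCleanElem_toAddMonoidEnd_of_isFiniteLength hfin).map g
  convert this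
  exact LinearMap.ext fun v => (hX v).symm

end FiniteLength

/-! ### Matrix and product factors of a semisimple ring. -/

section Semisimple

open Matrix

theorem nonempty_ringEquiv_zmod_two {D : Type*} [DivisionRing D] (h : ∀ x : D, x = 0 ∨ x = 1) :
    Nonempty (D ≃+* ZMod 2) := by
  have hcard : Nat.card D = 2 :=
    Nat.card_eq_two_iff.mpr ⟨0, 1, zero_ne_one, Set.eq_univ_of_forall h⟩
  have : Finite D := Nat.finite_of_card_ne_zero (by omega)
  have := Fintype.ofFinite D
  exact ⟨(ZMod.ringEquivOfPrime D Nat.prime_two (by rwa [← Nat.card_eq_fintype_card])).symm⟩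

variable {ι D : Type*} [Fintype ι] [DecidableEq ι] [DivisionRing D]

theorem not_isUnit_single [Nontrivial ι] (i : ι) (d : D) :
    ¬ IsUnit (single i i d : Matrix ι ι D) := by
  intro h
  obtain ⟨j, hj⟩ := exists_ne i
  obtain ⟨B, hB, -⟩ := isUnit_iff_exists.mp h
  have := congrFun (congrFun hB j) j
  simp [single_mul_apply_of_ne, hj] at this

theorem nonempty_ringEquiv_zmod_two_of_isNilCleanElem_single (i : ι)
    (h : ∀ d : D, IsNilCleanElem (single i i d : Matrix ι ι D)) : Nonempty (D ≃+* ZMod 2) :=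
  nonempty_ringEquiv_zmod_two fun d => eq_zero_or_eq_one_of_isNilCleanElem_single (h d)

theorem IsNilCleanRing.matrix_ringEquiv [Nonempty ι] (h : IsNilCleanRing (Matrix ι ι D)) :
    Nonempty (Matrix ι ι D ≃+* Matrix ι ι (ZMod 2)) :=
  (nonempty_ringEquiv_zmod_two_of_isNilCleanElem_single (Classical.arbitrary ι) fun _ => h _).map
    fun e => e.mapMatrix

theorem IsGNCRing.matrix_ringEquiv [Nontrivial ι] (h : IsGNCRing (Matrix ι ι D)) :
    Nonempty (Matrix ι ι D ≃+* Matrix ι ι (ZMod 2)) :=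
  (nonempty_ringEquiv_zmod_two_of_isNilCleanElem_single (Classical.arbitrary ι) fun d =>
    isGNCRing_iff.mp h _ (not_isUnit_single _ d)).map fun e => e.mapMatrix

/-- Every factor of a GNC product with at least two nonzero factors is nil-clean. -/
theorem IsGNCRing.isNilCleanRing_of_pi {κ : Type*} [Nontrivial κ] {A : κ → Type*}
    [∀ k, Ring (A k)] [∀ k, Nontrivial (A k)] (h : IsGNCRing (∀ k, A k)) (k : κ) :
    IsNilCleanRing (A k) := by
  classical
  intro a
  obtain ⟨l, hl⟩ := exists_ne k
  have hu : ¬ IsUnit (Pi.single k a : ∀ k, A k) := fun hu => by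
    have := hu.map (Pi.evalRingHom A l)
    simp [hl] at this
  simpa using (isGNCRing_iff.mp h _ hu).map (Pi.evalRingHom A k)

theorem isNilCleanRing_pi {κ : Type*} [Finite κ] {A : κ → Type*} [∀ k, Ring (A k)]
    (h : ∀ k, IsNilCleanRing (A k)) : IsNilCleanRing (∀ k, A k) := by
  have := Fintype.ofFinite κ
  intro a
  choose e he n hn using fun k => h k (a k)
  refine ⟨e, funext he, ∑ k, n k, funext fun k => ?_⟩
  exact pow_eq_zero_of_le (Finset.single_le_sum (fun _ _ => Nat.zero_le _) (Finset.mem_univ k))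
    (hn k)

end Semisimple

theorem IsGNCRing.trichotomy {R : Type*} [Ring R] [IsSemisimpleRing (R ⧸ Ring.jacobson R)]
    (h : IsGNCRing R) :
    IsLocalRing R ∨
      (∃ n : ℕ, 1 ≤ n ∧
        Nonempty ((R ⧸ Ring.jacobson R) ≃+* Matrix (Fin n) (Fin n) (ZMod 2))) ∨
      IsNilCleanRing (R ⧸ Ring.jacobson R) := by
  have hS : IsGNCRing (R ⧸ Ring.jacobson R) :=
    h.of_surjective (Ideal.Quotient.mk _) Ideal.Quotient.mk_surjective
  obtain ⟨m, D, d, _, hd, ⟨e⟩⟩ :=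
    IsSemisimpleRing.exists_ringEquiv_pi_matrix_divisionRing (R ⧸ Ring.jacobson R)
  have hP := hS.of_surjective e.toRingHom e.surjective
  rcases subsingleton_or_nontrivial (Fin m) with hm | hm
  -- With no factors the quotient is zero, hence nil-clean.
  · rcases m with _ | m
    · have : Subsingleton (R ⧸ Ring.jacobson R) := e.injective.subsingleton
      exact .inr (.inr fun a => ⟨0, .zero, 1, Subsingleton.elim _ _⟩)
    let i : Fin (m + 1) := 0
    let _ : Unique (Fin (m + 1)) := { default := i, uniq := fun _ => Subsingleton.elim _ _ }
    let e' : (R ⧸ Ring.jacobson R) ≃+* Matrix (Fin (d i)) (Fin (d i)) (D i) :=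
      e.trans (RingEquiv.piUnique fun i => Matrix (Fin (d i)) (Fin (d i)) (D i))
    rcases subsingleton_or_nontrivial (Fin (d i)) with hdi | hdi
    · left
      let _ : Unique (Fin (d i)) := { default := 0, uniq := fun _ => Subsingleton.elim _ _ }
      obtain ⟨g⟩ : Nonempty (Matrix (Fin (d i)) (Fin (d i)) (D i) ≃+* D i) := by
        convert! Nonempty.intro (Matrix.uniqueRingEquiv (m := Fin (d i)) (A := D i))
      let f : (R ⧸ Ring.jacobson R) ≃+* D i := e'.trans g
      have : Nontrivial (R ⧸ Ring.jacobson R) := f.symm.injective.nontrivial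
      have : Nontrivial R := (Ideal.Quotient.mk (Ring.jacobson R)).domain_nontrivial
      refine isLocalRing_of_quotient_jacobson fun x => ?_
      rcases eq_or_ne (f x) 0 with hx | hx
      · exact .inl ((map_eq_zero_iff f f.injective).mp hx)
      · exact .inr ((MulEquiv.isUnit_map f).mp hx.isUnit)
    · right; left
      obtain ⟨g⟩ := (hS.of_surjective e'.toRingHom e'.surjective).matrix_ringEquiv
      exact ⟨d i, NeZero.one_le, ⟨e'.trans g⟩⟩
  · right; right
    refine IsNilCleanRing.of_surjective e.symm.toRingHom e.symm.surjective
      (isNilCleanRing_pi fun i => ?_)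
    obtain ⟨g⟩ := (hP.isNilCleanRing_of_pi i).matrix_ringEquiv
    exact (isNilCleanRing_matrix_zmod_two _).of_surjective g.symm.toRingHom g.symm.surjective

theorem theorem2 (R : Type*) [Ring R] (hR : IsSemilocalRing R) :
    IsGNCRing R ↔
      (IsLocalRing R ∧ HasNilJacobson R) ∨
      ((∃ n : ℕ, 1 ≤ n ∧
          Nonempty ((R ⧸ Ring.jacobson R) ≃+* Matrix (Fin n) (Fin n) (ZMod 2))) ∧
        HasNilJacobson R) ∨
      IsNilCleanRing R := by
  have : IsSemisimpleRing (R ⧸ Ring.jacobson R) := hR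
  constructor
  · intro h
    have hJ := h.hasNilJacobson
    rcases h.trichotomy with hl | hm | hc
    · exact .inl ⟨hl, hJ⟩
    · exact .inr (.inl ⟨hm, hJ⟩)
    · exact .inr (.inr (hJ.isNilCleanRing hc))
  · rintro (⟨hl, hJ⟩ | ⟨⟨n, -, ⟨e⟩⟩, hJ⟩ | h)
    · exact IsLocalRing.isGNCRing_of_hasNilJacobson hJ
    · exact (hJ.isNilCleanRing ((isNilCleanRing_matrix_zmod_two (Fin n)).of_surjective
        e.symm.toRingHom e.symm.surjective)).isGNCRing
    · exact h.isGNCRing
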